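/- Let $X$ be a complete metric space equipped with a partial order $\le$ whose graph $\{(x,y) : x\le y\}\subseteq X\times X$ is closed. Call a function $f:X\to\mathbb{R}$ short if $|f(x)-f(y)|\le d(x,y)$ for all $x,y\in X$. Suppose that $X$ is L-ordered, i.e. for all $x,y\in X$ one has $x\le y$ if and only if $f(x)\le f(y)$ for every short monotone function $f:X\to\mathbb{R}$. Let $p$ and $q$ be Radon probability measures on $X$ (Borel probability measures that are inner regular with respect to compact sets) of finite first moment, i.e. such that every short function $X\to\mathbb{R}$ is integrable with respect to $p$ and to $q$. Then the following are equivalent: (i) $p\le q$ in the stochastic order, i.e. there is a coupling of $p$ and $q$ (a Radon probability measure $r$ on $X\times X$ with first marginal $p$ and second marginal $q$) which is supported on the graph of the order: $r(\{(x,y) : x\not\le y\})=0$; (ii) for every short monotone function $f:X\to\mathbb{R}$, $$\int_X f\,dp\le\int_X f\,dq .$$ -/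

import Mathlib

open MeasureTheory Topology

/-- A metric space with a partial order is *L-ordered* if the order is the one detected by the
short (that is, 1-Lipschitz) monotone real functions. -/
def IsLOrdered (X : Type*) [MetricSpace X] [PartialOrder X] : Prop :=
  ∀ x y : X, x ≤ y ↔ ∀ f : X → ℝ, LipschitzWith 1 f → Monotone f → f x ≤ f y

/-- The measure `p` has finite first moment: every short real function is integrable. -/
def HasFiniteFirstMoment {X : Type*} [MetricSpace X] [MeasurableSpace X]
    (p : Measure X) : Prop :=
  ∀ f : X → ℝ, LipschitzWith 1 f → Integrable f p

/-- `p` is an element of `PX`: a Radon probability measure of finite first moment. Here Radon means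
inner regular with respect to compact sets on all measurable (= Borel) sets. -/
structure IsKantorovichMeasure {X : Type*} [MetricSpace X] [MeasurableSpace X]
    (p : Measure X) : Prop where
  isProbabilityMeasure : IsProbabilityMeasure p
  radon : p.InnerRegular
  finiteFirstMoment : HasFiniteFirstMoment p

/-- `r` is a coupling of `p` and `q`: a Radon probability measure on the Borel sets of the
topological space `X × X` whose marginals are `p` and `q`.  The Borel σ-algebra of `X × X` is given
explicitly, since for non-separable `X` it can be larger than the product σ-algebra. -/
structure IsCoupling {X : Type*} [MetricSpace X] [MeasurableSpace X]
    (p q : Measure X) (r : @Measure (X × X) (borel (X × X))) : Prop where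
  isProbabilityMeasure : @IsProbabilityMeasure (X × X) (borel (X × X)) r
  radon : @Measure.InnerRegular (X × X) (borel (X × X)) _ r
  map_fst : @Measure.map (X × X) X (borel (X × X)) _ Prod.fst r = p
  map_snd : @Measure.map (X × X) X (borel (X × X)) _ Prod.snd r = q

/-- The stochastic order: some coupling of `p` and `q` is supported on the graph of `≤`,
that is, the complement of the graph is a null set. -/
def StochasticLE {X : Type*} [MetricSpace X] [PartialOrder X] [MeasurableSpace X]
    (p q : Measure X) : Prop :=
  ∃ r : @Measure (X × X) (borel (X × X)), IsCoupling p q r ∧ r {z : X × X | ¬ z.1 ≤ z.2} = 0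

/-- Being supported on the graph of `≤`, in terms of neighbourhoods: every pair of points outside
the graph has a null neighbourhood of the form `U × V`. -/
theorem IsCoupling.null_iff_forall_nhds {X : Type*} [MetricSpace X] [PartialOrder X]
    [OrderClosedTopology X] [MeasurableSpace X] {p q : Measure X}
    {r : @Measure (X × X) (borel (X × X))} (hr : IsCoupling p q r) :
    r {z : X × X | ¬ z.1 ≤ z.2} = 0 ↔
      ∀ x y : X, ¬ x ≤ y → ∃ U V : Set X, IsOpen U ∧ IsOpen V ∧ x ∈ U ∧ y ∈ V ∧ r (U ×ˢ V) = 0 := by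
  letI : MeasurableSpace (X × X) := borel (X × X)
  haveI : BorelSpace (X × X) := ⟨rfl⟩
  have hopen : IsOpen {z : X × X | ¬ z.1 ≤ z.2} :=
    (isClosed_le continuous_fst continuous_snd).isOpen_compl
  constructor
  · intro h x y hxy
    obtain ⟨U, V, hU, hV, hx, hy, hUV⟩ := isOpen_prod_iff.1 hopen x y hxy
    exact ⟨U, V, hU, hV, hx, hy, measure_mono_null hUV h⟩
  · intro h
    have hreg : r.InnerRegular := hr.radon
    by_contra hne
    obtain ⟨K, hKs, hK, hpos⟩ :=
      hreg.innerRegular hopen.measurableSet 0 (pos_iff_ne_zero.2 hne)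
    refine hpos.ne' (hK.measure_zero_of_nhdsWithin fun z hz => ?_)
    obtain ⟨U, V, hU, hV, hx, hy, h0⟩ := h z.1 z.2 (hKs hz)
    exact ⟨U ×ˢ V, mem_nhdsWithin_of_mem_nhds ((hU.prod hV).mem_nhds ⟨hx, hy⟩), h0⟩

/-!
The implication from a coupling to the inequalities of integrals is immediate. For the converse, put
`c x y = sup (f x - f y)`, the supremum over all short monotone `f` (`orderCost`). This is a
nonnegative cost with `c ≤ dist` that satisfies the triangle inequality and, as `X` is L-ordered,
vanishes exactly on the graph of `≤`. So it is enough to find a coupling of `p` and `q` whose mass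
lies where `c` vanishes. This is Kantorovich duality for `c`.

* The dual inequality (`integral_add_integral_nonneg`): if `φ x + ψ y + a * c x y ≥ 0` everywhere,
  then `∫ φ dp + ∫ ψ dq ≥ 0`. Indeed `f x = inf_y (ψ y + a * c x y)` lies between `-φ` and `ψ`, and
  `a⁻¹ f` is short and monotone by the triangle inequality for `c`.
* By the dual inequality, `h ↦ inf {∫ φ dp + ∫ ψ dq | h x y ≤ φ x + ψ y + a * c x y, a ≥ 0}` is
  a finite sublinear functional; a linear functional below it (Hahn–Banach) is positive, has the
  marginals `p` and `q`, and is nonpositive on each `h ≤ a * c`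
  (`exists_linearMap_le_integral_add_integral`).
* To turn it into a measure, `X` is mapped continuously into the Hilbert cube `Q` by the truncated
  distances to a countable set dense in a closed separable set `S` that carries `p` and `q`
  (`cappedDist`). The functional on `C(Q × Q)` is a measure by Riesz–Markov–Kakutani
  (`exists_measure_prod_of_continuous`). Its marginals are carried by the image of `S`, and `S → Q`
  is a measurable embedding by the Lusin–Souslin theorem, so the measure comes back to `S × S` and
  from there to `X × X`. Bump functions on `Q × Q` show that it gives no mass to the open set of the
  points near which `c` is bounded below by a positive number
  (`exists_isCoupling_measure_eq_zero`).
-/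

/-! ### The cost of leaving the order -/

theorem LipschitzWith.sub_le_dist {X : Type*} [MetricSpace X] {f : X → ℝ}
    (hf : LipschitzWith 1 f) (x y : X) : f x - f y ≤ dist x y := by
  have := hf.dist_le_mul x y
  rw [Real.dist_eq] at this
  simpa using (le_abs_self _).trans this

section OrderCost
variable {X : Type*} [MetricSpace X] [PartialOrder X]

/-- The short monotone real functions on `X`. -/
abbrev ShortMonotone (X : Type*) [MetricSpace X] [PartialOrder X] : Type _ :=
  {f : X → ℝ // LipschitzWith 1 f ∧ Monotone f}

/-- The largest decrease `f x - f y` of a short monotone function `f` from `x` to `y`. The supremum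
is taken over a nonempty family bounded by `dist x y`, so it is a genuine one. -/
noncomputable def orderCost (x y : X) : ℝ :=
  ⨆ f : ShortMonotone X, (f.1 x - f.1 y)

instance : Nonempty (ShortMonotone X) :=
  ⟨⟨fun _ => 0, LipschitzWith.of_dist_le_mul (by simp), monotone_const⟩⟩

theorem bddAbove_orderCost (x y : X) :
    BddAbove (Set.range fun f : ShortMonotone X => f.1 x - f.1 y) :=
  ⟨dist x y, by rintro _ ⟨f, rfl⟩; exact f.2.1.sub_le_dist x y⟩

theorem sub_le_orderCost {f : X → ℝ} (hf : LipschitzWith 1 f) (hm : Monotone f) (x y : X) :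
    f x - f y ≤ orderCost x y :=
  le_ciSup (bddAbove_orderCost x y) ⟨f, hf, hm⟩

theorem orderCost_le_dist (x y : X) : orderCost x y ≤ dist x y :=
  ciSup_le fun f => f.2.1.sub_le_dist x y

theorem orderCost_nonneg (x y : X) : 0 ≤ orderCost x y := by
  simpa using sub_le_orderCost (LipschitzWith.of_dist_le_mul (K := 1) (f := fun _ : X => (0 : ℝ))
    (by simp)) monotone_const x y

theorem orderCost_of_le {x y : X} (h : x ≤ y) : orderCost x y = 0 :=
  le_antisymm (ciSup_le fun f => sub_nonpos.2 (f.2.2 h)) (orderCost_nonneg x y)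

theorem orderCost_triangle (x y z : X) : orderCost x z ≤ orderCost x y + orderCost y z :=
  ciSup_le fun f => by
    linarith [sub_le_orderCost f.2.1 f.2.2 x y, sub_le_orderCost f.2.1 f.2.2 y z]

theorem orderCost_pos (hX : IsLOrdered X) {x y : X} (h : ¬ x ≤ y) : 0 < orderCost x y := by
  rw [hX x y] at h
  push Not at h
  obtain ⟨f, hf, hm, hlt⟩ := h
  exact (sub_pos.2 hlt).trans_le (sub_le_orderCost hf hm x y)

variable [MeasurableSpace X]

/-- The dual side of Kantorovich duality for the cost `orderCost`: an inequality between `p` and `q`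
on short monotone functions extends to pairs of potentials. -/
theorem integral_add_integral_nonneg {p q : Measure X} [IsProbabilityMeasure p]
    (hp : HasFiniteFirstMoment p) (hq : HasFiniteFirstMoment q)
    (hpq : ∀ f : X → ℝ, LipschitzWith 1 f → Monotone f → ∫ x, f x ∂p ≤ ∫ x, f x ∂q)
    {φ ψ : X → ℝ} (hφ : Integrable φ p) (hψ : Integrable ψ q) {a : ℝ} (ha : 0 ≤ a)
    (h : ∀ x y, 0 ≤ φ x + ψ y + a * orderCost x y) :
    0 ≤ ∫ x, φ x ∂p + ∫ x, ψ x ∂q := by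
  -- Since the cost is nonnegative, `a` may be increased; below one divides by it.
  wlog ha' : 0 < a generalizing a
  · refine this (a := a + 1) (by positivity) (fun x y => ?_) (by positivity)
    nlinarith [h x y, orderCost_nonneg x y]
  have : Nonempty X := nonempty_of_isProbabilityMeasure p
  -- The transform of `ψ` with respect to the cost; `hφf` and `hfψ` place it between `-φ` and `ψ`.
  let f : X → ℝ := fun x => ⨅ y, (ψ y + a * orderCost x y)
  have hb (x) : BddBelow (Set.range fun y => ψ y + a * orderCost x y) :=
    ⟨-φ x, by rintro _ ⟨y, rfl⟩; linarith [h x y]⟩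
  have hφf (x) : -f x ≤ φ x := by
    have : -φ x ≤ f x := le_ciInf fun y => by linarith [h x y]
    linarith
  have hfψ (x) : f x ≤ ψ x := by
    simpa [orderCost_of_le le_rfl] using ciInf_le (hb x) x
  have hf (x x') : f x ≤ f x' + a * orderCost x x' := by
    rw [← sub_le_iff_le_add]
    refine le_ciInf fun y => ?_
    have h1 : f x ≤ _ := ciInf_le (hb x) y
    nlinarith [orderCost_triangle x x' y]
  have hg1 : LipschitzWith 1 fun x => a⁻¹ * f x := by
    refine LipschitzWith.of_le_add_mul 1 fun x y => ?_
    have h1 := mul_le_mul_of_nonneg_left (hf x y) (inv_nonneg.2 ha)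
    rw [mul_add, inv_mul_cancel_left₀ ha'.ne'] at h1
    simpa using h1.trans (by gcongr; exact orderCost_le_dist x y)
  have hg2 : Monotone fun x => a⁻¹ * f x := fun x y hxy => by
    have := hf x y
    rw [orderCost_of_le hxy] at this
    simp only
    gcongr
    linarith
  have hfp : Integrable f p := by simpa [ha'.ne'] using (hp _ hg1).const_mul a
  have hfq : Integrable f q := by simpa [ha'.ne'] using (hq _ hg1).const_mul a
  have h1 := hpq _ hg1 hg2
  rw [integral_const_mul, integral_const_mul, mul_le_mul_iff_right₀ (by positivity)] at h1
  have h2 := integral_mono hfp.neg hφ hφf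
  have h3 := integral_mono hfq hψ hfψ
  simp only [Pi.neg_apply, integral_neg] at h2
  linarith

end OrderCost

/-! ### A functional with prescribed marginals -/

/-- Hahn–Banach step of Kantorovich duality. `E` stands for a space of bounded functions on `X × X`
through the evaluation `ev`. The functional `Λ` has the marginals `p` and `q` and is nonpositive on
the functions dominated by a multiple of `c`; both are instances of the one inequality stated. -/
theorem exists_linearMap_le_integral_add_integral {X E : Type*} [MeasurableSpace X]
    {p q : Measure X} [IsProbabilityMeasure p] [IsProbabilityMeasure q] [AddCommGroup E]
    [Module ℝ E] (ev : E →ₗ[ℝ] X → X → ℝ) (hev : ∀ h, ∃ M, ∀ x y, |ev h x y| ≤ M) (c : X → X → ℝ)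
    (hc : ∀ φ ψ : X → ℝ, Integrable φ p → Integrable ψ q → ∀ a : ℝ, 0 ≤ a →
      (∀ x y, 0 ≤ φ x + ψ y + a * c x y) → 0 ≤ ∫ x, φ x ∂p + ∫ x, ψ x ∂q) :
    ∃ Λ : E →ₗ[ℝ] ℝ, ∀ h, ∀ φ ψ : X → ℝ, Integrable φ p → Integrable ψ q → ∀ a : ℝ, 0 ≤ a →
      (∀ x y, ev h x y ≤ φ x + ψ y + a * c x y) → Λ h ≤ ∫ x, φ x ∂p + ∫ x, ψ x ∂q := by
  let A (h : E) : Set ℝ := {v | ∃ φ ψ : X → ℝ, Integrable φ p ∧ Integrable ψ q ∧ ∃ a : ℝ, 0 ≤ a ∧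
      (∀ x y, ev h x y ≤ φ x + ψ y + a * c x y) ∧ ∫ x, φ x ∂p + ∫ x, ψ x ∂q = v}
  have hA0 (h) : (A h).Nonempty := by
    obtain ⟨M, hM⟩ := hev h
    exact ⟨_, fun _ => M, fun _ => 0, integrable_const _, integrable_const _, 0, le_rfl,
      fun x y => by simpa using (le_abs_self _).trans (hM x y), rfl⟩
  -- The sublinear functional `h ↦ sInf (A h)` is finite by the dual inequality `hc`.
  have hAb (h) : BddBelow (A h) := by
    obtain ⟨M, hM⟩ := hev h
    refine ⟨-M, ?_⟩
    rintro _ ⟨φ, ψ, hφ, hψ, a, ha, hle, rfl⟩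
    have := hc (fun x => φ x + M) ψ (hφ.add (integrable_const M)) hψ a ha fun x y => by
      linarith [hle x y, neg_le_of_abs_le (hM x y)]
    rw [integral_add hφ (integrable_const M)] at this
    simp only [integral_const, probReal_univ, one_smul] at this
    linarith
  have hsmul {t : ℝ} (ht : 0 < t) (h : E) : ∀ v ∈ A h, t * v ∈ A (t • h) := by
    rintro _ ⟨φ, ψ, hφ, hψ, a, ha, hle, rfl⟩
    refine ⟨_, _, hφ.const_mul t, hψ.const_mul t, t * a, by positivity, fun x y => ?_, ?_⟩
    · have := mul_le_mul_of_nonneg_left (hle x y) ht.le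
      simp only [map_smul, Pi.smul_apply, smul_eq_mul]
      linarith
    · rw [integral_const_mul, integral_const_mul, mul_add]
  have hsmul_le {t : ℝ} (ht : 0 < t) (h : E) : sInf (A (t • h)) ≤ t * sInf (A h) := by
    rw [← div_le_iff₀' ht]
    refine le_csInf (hA0 h) fun v hv => ?_
    rw [div_le_iff₀' ht]
    exact csInf_le (hAb _) (hsmul ht h v hv)
  obtain ⟨Λ, -, hΛ⟩ := exists_extension_of_le_sublinear (⊥ : E →ₗ.[ℝ] ℝ) (fun h => sInf (A h))
    (fun t ht h => by
      refine le_antisymm (hsmul_le ht h) ?_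
      have := hsmul_le (inv_pos.2 ht) (t • h)
      rw [inv_smul_smul₀ ht.ne'] at this
      rwa [← le_inv_mul_iff₀ ht])
    (fun h k => by
      rw [← sub_le_iff_le_add']
      refine le_csInf (hA0 k) ?_
      rintro _ ⟨φ, ψ, hφ, hψ, a, ha, hle, rfl⟩
      rw [sub_le_comm]
      refine le_csInf (hA0 h) ?_
      rintro _ ⟨φ', ψ', hφ', hψ', a', ha', hle', rfl⟩
      rw [sub_le_iff_le_add]
      refine csInf_le (hAb _) ⟨_, _, hφ'.add hφ, hψ'.add hψ, a' + a, by positivity,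
        fun x y => ?_, ?_⟩
      · simp only [map_add, Pi.add_apply]
        linarith [hle x y, hle' x y]
      · rw [integral_add' hφ' hφ, integral_add' hψ' hψ]
        ring)
    (fun x => by
      have hx : (x : E) = 0 := (Submodule.mem_bot ℝ).1 x.2
      have hx' : x = 0 := Subtype.ext hx
      subst hx'
      rw [LinearPMap.map_zero]
      refine le_csInf (hA0 _) ?_
      rintro _ ⟨φ, ψ, hφ, hψ, a, ha, hle, rfl⟩
      exact hc φ ψ hφ hψ a ha fun x y => by simpa using hle x y)
  exact ⟨Λ, fun h φ ψ hφ hψ a ha hle =>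
    (hΛ h).trans (csInf_le (hAb h) ⟨φ, ψ, hφ, hψ, a, ha, hle, rfl⟩)⟩

/-! ### Representation by a measure on a compact space -/

theorem MeasureTheory.Measure.exists_isClosed_isSeparable_measure_compl_eq_zero {X : Type*}
    [MetricSpace X] [MeasurableSpace X] [BorelSpace X] (μ : Measure X) [IsFiniteMeasure μ]
    [μ.InnerRegular] :
    ∃ S : Set X, IsClosed S ∧ TopologicalSpace.IsSeparable S ∧ μ Sᶜ = 0 := by
  have h := isTightMeasureSet_iff_exists_isCompact_measure_compl_le.1
    (isTightMeasureSet_singleton_of_innerRegular (μ := μ))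
  have h' (n : ℕ) := h ((n : ENNReal) + 1)⁻¹ (by simp)
  choose K hK hμ using h'
  refine ⟨closure (⋃ n, K n), isClosed_closure,
    (TopologicalSpace.IsSeparable.iUnion fun n => (hK n).isSeparable).closure, ?_⟩
  refine le_antisymm (ENNReal.le_of_forall_pos_le_add fun ε hε _ => ?_) zero_le
  obtain ⟨n, hn⟩ := ENNReal.exists_inv_nat_lt (ENNReal.coe_pos.2 hε).ne'
  calc μ (closure (⋃ n, K n))ᶜ ≤ μ (K n)ᶜ :=
        measure_mono (Set.compl_subset_compl.2 ((Set.subset_iUnion K n).trans subset_closure))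
    _ ≤ ((n : ENNReal) + 1)⁻¹ := hμ n μ rfl
    _ ≤ (n : ENNReal)⁻¹ := ENNReal.inv_le_inv.2 le_self_add
    _ ≤ 0 + ε := by rw [zero_add]; exact hn.le

open CompactlySupported in
/-- The functional of `exists_linearMap_le_integral_add_integral`, on the continuous functions on
the square of a compact space `Q` into which `X` is mapped, is integration against a measure. -/
theorem exists_measure_prod_of_continuous {X Q : Type*} [TopologicalSpace X] [MeasurableSpace X]
    [BorelSpace X] [TopologicalSpace Q] [CompactSpace Q] [TopologicalSpace.MetrizableSpace Q]
    [SecondCountableTopology Q] [MeasurableSpace Q] [BorelSpace Q] {p q : Measure X}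
    [IsProbabilityMeasure p] [IsProbabilityMeasure q] {c : X → X → ℝ}
    (hc : ∀ φ ψ : X → ℝ, Integrable φ p → Integrable ψ q → ∀ a : ℝ, 0 ≤ a →
      (∀ x y, 0 ≤ φ x + ψ y + a * c x y) → 0 ≤ ∫ x, φ x ∂p + ∫ x, ψ x ∂q)
    {i : X → Q} (hi : Continuous i) :
    ∃ r : Measure (Q × Q), IsProbabilityMeasure r ∧ r.map Prod.fst = p.map i ∧
      r.map Prod.snd = q.map i ∧ ∀ h : Q × Q → ℝ, Continuous h → 0 ≤ h → ∀ a : ℝ, 0 ≤ a →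
        (∀ x y, h (i x, i y) ≤ a * c x y) → h =ᵐ[r] 0 := by
  let ev : C_c(Q × Q, ℝ) →ₗ[ℝ] X → X → ℝ :=
    { toFun := fun h x y => h (i x, i y)
      map_add' := fun _ _ => rfl
      map_smul' := fun _ _ => rfl }
  obtain ⟨Λ, hΛ⟩ := exists_linearMap_le_integral_add_integral ev
    (fun h => by
      obtain ⟨M, hM⟩ := isCompact_univ.exists_bound_of_continuousOn h.continuous.continuousOn
      exact ⟨M, fun x y => hM _ trivial⟩) c hc
  let L : C_c(Q × Q, ℝ) →ₚ[ℝ] ℝ := PositiveLinearMap.mk₀ Λ fun h hh => by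
    have := hΛ (-h) (fun _ => 0) (fun _ => 0) (integrable_const _) (integrable_const _) 0 le_rfl
      fun x y => by simpa [ev] using hh (i x, i y)
    simpa using this
  let cc : C(Q × Q, ℝ) ≃ C_c(Q × Q, ℝ) := CompactlySupportedContinuousMap.continuousMapEquiv
  let r := RealRMK.rieszMeasure L
  have hr (h : C(Q × Q, ℝ)) : ∫ z, h z ∂r = Λ (cc h) := RealRMK.integral_rieszMeasure L (cc h)
  -- The marginals: `hΛ` gives one inequality, and the other one by passing to `-f`.
  have hfst (f : C(Q, ℝ)) : ∫ z, f z.1 ∂r = ∫ x, f (i x) ∂p := by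
    have hle (f : C(Q, ℝ)) : ∫ z, f z.1 ∂r ≤ ∫ x, f (i x) ∂p := by
      have hf : Integrable (fun x => f (i x)) p :=
        (BoundedContinuousFunction.mkOfCompact f |>.compContinuous ⟨i, hi⟩).integrable p
      have := hΛ (cc (f.comp ⟨Prod.fst, continuous_fst⟩)) _ (fun _ => 0) hf (integrable_const _) 0
        le_rfl fun x y => by simp [ev, cc]
      rw [← hr] at this
      simpa using this
    refine le_antisymm (hle f) ?_
    simpa [integral_neg] using hle (-f)
  have hsnd (f : C(Q, ℝ)) : ∫ z, f z.2 ∂r = ∫ x, f (i x) ∂q := by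
    have hle (f : C(Q, ℝ)) : ∫ z, f z.2 ∂r ≤ ∫ x, f (i x) ∂q := by
      have hf : Integrable (fun x => f (i x)) q :=
        (BoundedContinuousFunction.mkOfCompact f |>.compContinuous ⟨i, hi⟩).integrable q
      have := hΛ (cc (f.comp ⟨Prod.snd, continuous_snd⟩)) (fun _ => 0) _ (integrable_const _) hf 0
        le_rfl fun x y => by simp [ev, cc]
      rw [← hr] at this
      simpa using this
    refine le_antisymm (hle f) ?_
    simpa [integral_neg] using hle (-f)
  have hfst' : r.map Prod.fst = p.map i := by
    refine ext_of_forall_integral_eq_of_IsFiniteMeasure fun f => ?_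
    rw [integral_map measurable_fst.aemeasurable f.continuous.aestronglyMeasurable,
      integral_map hi.measurable.aemeasurable f.continuous.aestronglyMeasurable]
    exact hfst f
  have hsnd' : r.map Prod.snd = q.map i := by
    refine ext_of_forall_integral_eq_of_IsFiniteMeasure fun f => ?_
    rw [integral_map measurable_snd.aemeasurable f.continuous.aestronglyMeasurable,
      integral_map hi.measurable.aemeasurable f.continuous.aestronglyMeasurable]
    exact hsnd f
  refine ⟨r, ⟨?_⟩, hfst', hsnd', fun h hh h0 a ha hle => ?_⟩
  · have := congrArg (fun μ => μ Set.univ) hfst'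
    simpa [Measure.map_apply measurable_fst MeasurableSet.univ,
      Measure.map_apply hi.measurable MeasurableSet.univ] using this
  · have hint : Integrable h r :=
      (BoundedContinuousFunction.mkOfCompact (⟨h, hh⟩ : C(Q × Q, ℝ))).integrable r
    refine (integral_eq_zero_iff_of_nonneg h0 hint).1 (le_antisymm ?_ (integral_nonneg h0))
    have := hΛ (cc ⟨h, hh⟩) (fun _ => 0) (fun _ => 0) (integrable_const _) (integrable_const _) a ha
      fun x y => by simpa [ev, cc] using hle x y
    rw [← hr] at this
    simpa using this

/-! ### Mapping to the Hilbert cube -/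

section Bump
variable {X : Type*} [MetricSpace X]

/-- The map to the Hilbert cube whose coordinates are the distances to the points of the sequence
`s`, truncated at `1`. -/
noncomputable def cappedDist (s : ℕ → X) (x : X) (n : ℕ) : unitInterval :=
  ⟨min 1 (dist x (s n)), le_min zero_le_one dist_nonneg, min_le_left _ _⟩

theorem continuous_cappedDist (s : ℕ → X) : Continuous (cappedDist s) :=
  continuous_pi fun n => Continuous.subtype_mk (by fun_prop) _

/-- At a point `x` of the closure of the sequence, the map `cappedDist s` is inducing, also with
respect to points `y` that are outside this closure. -/
theorem exists_bump_cappedDist {s : ℕ → X} {x : X} (hx : x ∈ closure (Set.range s)) {U : Set X}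
    (hU : U ∈ 𝓝 x) :
    ∃ u : (ℕ → unitInterval) → ℝ, Continuous u ∧ (∀ ξ, 0 ≤ u ξ ∧ u ξ ≤ 1) ∧
      0 < u (cappedDist s x) ∧ ∀ y, y ∉ U → u (cappedDist s y) = 0 := by
  obtain ⟨ε, hε, hεU⟩ := Metric.mem_nhds_iff.1 hU
  -- The bump function is positive where the `n`-th truncated distance is less than `δ`; as `δ ≤ 1`,
  -- the truncation does not matter there.
  let δ := min 1 (ε / 2)
  have hδ : 0 < δ := by positivity
  obtain ⟨_, ⟨n, rfl⟩, hn⟩ := Metric.mem_closure_iff.1 hx δ hδ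
  refine ⟨fun ξ => max 0 (δ - ξ n), by fun_prop, fun ξ => ⟨le_max_left _ _, max_le zero_le_one ?_⟩,
    lt_max_of_lt_right (sub_pos.2 (min_lt_of_right_lt hn)), fun y hy => max_eq_left ?_⟩
  · linarith [min_le_left 1 (ε / 2), (ξ n).2.1]
  · rw [sub_nonpos]
    refine le_min (min_le_left _ _) ((min_le_right _ _).trans ?_)
    have h1 : ε ≤ dist y x := not_lt.1 fun h => hy (hεU h)
    have h2 := dist_triangle_right y x (s n)
    linarith [min_le_right 1 (ε / 2)]

theorem injOn_cappedDist (s : ℕ → X) : Set.InjOn (cappedDist s) (closure (Set.range s)) := by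
  intro x hx y _ hxy
  by_contra hne
  obtain ⟨u, -, -, h1, h2⟩ := exists_bump_cappedDist hx (isOpen_compl_singleton.mem_nhds hne)
  rw [hxy, h2 y (by simp)] at h1
  exact h1.false

end Bump

/-! ### The coupling -/

/-- Primal side of Kantorovich duality at optimal value zero: under the dual inequality `hc`, there
is a coupling that gives no mass to the open set of the points near which `c` is bounded below by
a positive number. -/
theorem exists_isCoupling_measure_eq_zero {X : Type*} [MetricSpace X] [CompleteSpace X]
    [MeasurableSpace X] [BorelSpace X] {p q : Measure X} [IsProbabilityMeasure p]
    [IsProbabilityMeasure q] [p.InnerRegular] [q.InnerRegular] {c : X → X → ℝ}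
    (hc0 : ∀ x y, 0 ≤ c x y)
    (hc : ∀ φ ψ : X → ℝ, Integrable φ p → Integrable ψ q → ∀ a : ℝ, 0 ≤ a →
      (∀ x y, 0 ≤ φ x + ψ y + a * c x y) → 0 ≤ ∫ x, φ x ∂p + ∫ x, ψ x ∂q) :
    ∃ r : @Measure (X × X) (borel (X × X)), IsCoupling p q r ∧
      r {z | ∃ U V : Set X, U ∈ 𝓝 z.1 ∧ V ∈ 𝓝 z.2 ∧ ∃ ε > 0, ∀ x ∈ U, ∀ y ∈ V, ε ≤ c x y} = 0 := by
  obtain ⟨S, hS, hSsep, hS0⟩ := (p + q).exists_isClosed_isSeparable_measure_compl_eq_zero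
  rw [Measure.add_apply, add_eq_zero] at hS0
  have hSne : S.Nonempty := by
    by_contra h
    rw [Set.not_nonempty_iff_eq_empty] at h
    simp [h] at hS0
  have : Nonempty S := hSne.to_subtype
  have : CompleteSpace S := hS.completeSpace_coe
  have : TopologicalSpace.SeparableSpace S := hSsep.separableSpace
  have : SecondCountableTopology S := UniformSpace.secondCountable_of_separable S
  let s : ℕ → X := fun n => TopologicalSpace.denseSeq S n
  have hs (x : S) : (x : X) ∈ closure (Set.range s) := by
    have h := TopologicalSpace.denseRange_denseSeq S x
    have := map_mem_closure continuous_subtype_val h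
      (t := Set.range s) (by rintro _ ⟨n, rfl⟩; exact ⟨n, rfl⟩)
    exact this
  let i := cappedDist s
  have hi : Continuous i := continuous_cappedDist s
  let ι : S → ℕ → unitInterval := fun x => i x
  -- The Lusin–Souslin theorem: `S` is Polish, and `cappedDist s` is injective on `S`.
  have hι : MeasurableEmbedding ι :=
    (hi.comp continuous_subtype_val).measurableEmbedding fun x y hxy =>
      Subtype.ext (injOn_cappedDist s (hs x) (hs y) hxy)
  obtain ⟨r', hr', hfst, hsnd, hnull⟩ := exists_measure_prod_of_continuous hc hi
  let J : S × S → (ℕ → unitInterval) × (ℕ → unitInterval) := Prod.map ι ι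
  have hJ : MeasurableEmbedding J := hι.prodMap hι
  let v : S → X := Subtype.val
  have hv : MeasurableEmbedding v := MeasurableEmbedding.subtype_coe hS.measurableSet
  let r₀ : Measure (S × S) := r'.comap J
  have hlift {μ : Measure X} (h0 : μ Sᶜ = 0) : (μ.comap v).map v = μ := by
    rw [hv.map_comap, Subtype.range_coe]
    exact Measure.restrict_eq_self_of_ae_mem (mem_ae_iff.2 h0)
  have hrange {μ : Measure X} (h0 : μ Sᶜ = 0) : μ.map i (Set.range ι)ᶜ = 0 := by
    rw [Measure.map_apply hi.measurable hι.measurableSet_range.compl]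
    exact measure_mono_null (fun x hx hxS => hx ⟨⟨x, hxS⟩, rfl⟩) h0
  -- The marginals of `r'` are carried by the image of `S`, so pulling back loses no mass.
  have hJr : r₀.map J = r' := by
    rw [hJ.map_comap]
    refine Measure.restrict_eq_self_of_ae_mem ?_
    have h1 : ∀ᵐ z ∂r', z.1 ∈ Set.range ι := by
      refine ae_of_ae_map measurable_fst.aemeasurable (p := fun x => x ∈ Set.range ι) ?_
      rw [hfst]
      exact mem_ae_iff.2 (hrange hS0.1)
    have h2 : ∀ᵐ z ∂r', z.2 ∈ Set.range ι := by
      refine ae_of_ae_map measurable_snd.aemeasurable (p := fun x => x ∈ Set.range ι) ?_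
      rw [hsnd]
      exact mem_ae_iff.2 (hrange hS0.2)
    filter_upwards [h1, h2] with z h1 h2
    rw [Set.range_prodMap]
    exact ⟨h1, h2⟩
  have hmarg {π : S × S → S} {μ : Measure X} (hπ : Measurable π) (h0 : μ Sᶜ = 0)
      (h : (r₀.map π).map ι = μ.map i) : (r₀.map π).map v = μ := by
    have h2 : (r₀.map π).map ι = (μ.comap v).map ι := by
      rw [h]
      nth_rewrite 1 [← hlift h0]
      exact Measure.map_map hi.measurable hv.measurable
    rw [← hι.comap_map (r₀.map π), h2, hι.comap_map, hlift h0]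
  have hm1 : (r₀.map Prod.fst).map v = p := by
    refine hmarg measurable_fst hS0.1 ?_
    rw [← hfst, ← hJr, Measure.map_map hι.measurable measurable_fst,
      Measure.map_map measurable_fst hJ.measurable]
    rfl
  have hm2 : (r₀.map Prod.snd).map v = q := by
    refine hmarg measurable_snd hS0.2 ?_
    rw [← hsnd, ← hJr, Measure.map_map hι.measurable measurable_snd,
      Measure.map_map measurable_snd hJ.measurable]
    rfl
  have hr₀ : IsProbabilityMeasure r₀ := by
    rw [← hJr] at hr'
    exact (Measure.isProbabilityMeasure_map_iff hJ.measurable.aemeasurable).1 hr'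
  let _ : MeasurableSpace (X × X) := borel (X × X)
  have _ : BorelSpace (X × X) := ⟨rfl⟩
  have hvc : Continuous (Prod.map v v) := continuous_subtype_val.prodMap continuous_subtype_val
  -- `S × S` is Polish, so the finite measure `r₀` is tight.
  have hreg : r₀.InnerRegular := inferInstance
  refine ⟨r₀.map (Prod.map v v), ⟨Measure.isProbabilityMeasure_map hvc.measurable.aemeasurable,
    hreg.map_of_continuous hvc, ?_, ?_⟩, ?_⟩
  · rw [Measure.map_map continuous_fst.measurable hvc.measurable]
    rw [Measure.map_map hv.measurable measurable_fst] at hm1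
    exact hm1
  · rw [Measure.map_map continuous_snd.measurable hvc.measurable]
    rw [Measure.map_map hv.measurable measurable_snd] at hm2
    exact hm2
  · have hopen : IsOpen {z : X × X | ∃ U V : Set X, U ∈ 𝓝 z.1 ∧ V ∈ 𝓝 z.2 ∧
        ∃ ε > 0, ∀ x ∈ U, ∀ y ∈ V, ε ≤ c x y} := by
      rw [isOpen_iff_mem_nhds]
      rintro ⟨x, y⟩ ⟨U, V, hU, hV, h⟩
      filter_upwards [prod_mem_nhds (eventually_mem_nhds_iff.2 hU) (eventually_mem_nhds_iff.2 hV)]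
        with z hz using ⟨U, V, hz.1, hz.2, h⟩
    rw [Measure.map_apply hvc.measurable hopen.measurableSet]
    refine measure_null_of_locally_null _ fun z hz => ?_
    obtain ⟨U, V, hU, hV, ε, hε, h⟩ := hz
    obtain ⟨u, huc, hu, hu1, hu2⟩ := exists_bump_cappedDist (hs z.1) hU
    obtain ⟨w, hwc, hw, hw1, hw2⟩ := exists_bump_cappedDist (hs z.2) hV
    have h0 := hnull (fun ζ => u ζ.1 * w ζ.2) (by fun_prop)
      (fun ζ => mul_nonneg (hu _).1 (hw _).1) ε⁻¹ (by positivity) fun x y => by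
        have hcn : 0 ≤ ε⁻¹ * c x y := mul_nonneg (by positivity) (hc0 x y)
        by_cases hx : x ∈ U
        · by_cases hy : y ∈ V
          · have h1 : u (i x) * w (i y) ≤ 1 := mul_le_one₀ (hu _).2 (hw _).1 (hw _).2
            have h2 : 1 ≤ ε⁻¹ * c x y := by
              rw [← div_eq_inv_mul, one_le_div hε]
              exact h x hx y hy
            exact h1.trans h2
          · simpa [i, hw2 y hy] using hcn
        · simpa [i, hu2 x hx] using hcn
    rw [← hJr] at h0
    have h0' := ae_of_ae_map hJ.measurable.aemeasurable h0
    refine ⟨{z' : S × S | u (ι z'.1) * w (ι z'.2) ≠ 0}, mem_nhdsWithin_of_mem_nhds ?_, h0'⟩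
    refine IsOpen.mem_nhds ?_ (mul_pos hu1 hw1).ne'
    have hιc : Continuous ι := hi.comp continuous_subtype_val
    exact isOpen_ne_fun (by fun_prop) continuous_const

/-! ### The stochastic order -/

theorem mainTheorem3 {X : Type*} [MetricSpace X] [CompleteSpace X] [PartialOrder X]
    [OrderClosedTopology X] [MeasurableSpace X] [BorelSpace X] (hX : IsLOrdered X)
    (p q : Measure X) (hp : IsKantorovichMeasure p) (hq : IsKantorovichMeasure q) :
    StochasticLE p q ↔
      ∀ f : X → ℝ, LipschitzWith 1 f → Monotone f → ∫ x, f x ∂p ≤ ∫ x, f x ∂q := by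
  have := hp.isProbabilityMeasure
  have := hq.isProbabilityMeasure
  have := hp.radon
  have := hq.radon
  let _ : MeasurableSpace (X × X) := borel (X × X)
  have _ : BorelSpace (X × X) := ⟨rfl⟩
  constructor
  · rintro ⟨r, hr, h0⟩ f hf hm
    have h1 : MeasurePreserving Prod.fst r p := ⟨continuous_fst.measurable, hr.map_fst⟩
    have h2 : MeasurePreserving Prod.snd r q := ⟨continuous_snd.measurable, hr.map_snd⟩
    have hfp := hp.finiteFirstMoment f hf
    have hfq := hq.finiteFirstMoment f hf
    rw [← h1.map_eq, ← h2.map_eq,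
      integral_map h1.aemeasurable hf.continuous.stronglyMeasurable.aestronglyMeasurable,
      integral_map h2.aemeasurable hf.continuous.stronglyMeasurable.aestronglyMeasurable]
    refine integral_mono_ae (h1.integrable_comp_of_integrable hfp)
      (h2.integrable_comp_of_integrable hfq) ?_
    have hle : ∀ᵐ z ∂r, z.1 ≤ z.2 := h0
    filter_upwards [hle] with z hz using hm hz
  · intro h
    obtain ⟨r, hr, h0⟩ := exists_isCoupling_measure_eq_zero (p := p) (q := q)
      orderCost_nonneg fun φ ψ hφ hψ a ha hle => integral_add_integral_nonneg
        hp.finiteFirstMoment hq.finiteFirstMoment h hφ hψ ha hle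
    refine ⟨r, hr, measure_mono_null (fun z hz => ?_) h0⟩
    have hpos := orderCost_pos hX hz
    set ε := orderCost z.1 z.2 with hε
    -- The cost changes by at most the sum of the displacements of the two points.
    refine ⟨_, _, Metric.ball_mem_nhds z.1 (ε := ε / 4) (by positivity),
      Metric.ball_mem_nhds z.2 (ε := ε / 4) (by positivity), ε / 2, by positivity,
      fun x hx y hy => ?_⟩
    rw [Metric.mem_ball'] at hx
    rw [Metric.mem_ball] at hy
    linarith [orderCost_triangle z.1 x z.2, orderCost_triangle x y z.2, orderCost_le_dist z.1 x,
      orderCost_le_dist y z.2]
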